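/- **Theorem 4.** A Petri net with special arcs consists of a finite set $P$ of places, a finite set $T$ of transitions, an initial marking $M_0 : P \to \mathbb{N}$, weights $F(t,p) \in \mathbb{N}$ of arcs from transitions to places, and for each $(p,t) \in P \times T$ either an ordinary arc of weight $F(p,t) \in \mathbb{N}$ (weight $0$ meaning no arc), or an inhibitor arc, or a reset arc, or a transfer arc to some place $q \in P$. A transition $t$ is firable at a marking $M : P \to \mathbb{N}$ if $M(p) \ge F(p,t)$ for every ordinary arc $(p,t)$ and $M(p) = 0$ for every inhibitor arc $(p,t)$. Firing $t$ removes $F(p,t)$ tokens from each place $p$ with an ordinary arc to $t$, empties each place with a reset arc to $t$, moves all tokens of each place $p$ with a transfer arc to $q$ through $t$ into $q$, and then adds $F(t,p)$ tokens to each place $p$. The coverability problem asks, given a net and a marking $M$, whether some marking $M'$ with $M' \ge M$ componentwise is reachable from $M_0$ by firing transitions. (a) Coverability is undecidable for Petri nets that have exactly two reset arcs, exactly one inhibitor arc and no transfer arc. (b) Coverability is undecidable for Petri nets that have exactly two transfer arcs, exactly one inhibitor arc and no reset arc. -/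

import Mathlib

/-- The label of the pair `(p, t)`, a place and a transition, in the flow relation of a Petri net
with special arcs: an ordinary arc of some weight (weight `0`: no arc), an inhibitor arc,
a reset arc, or a transfer arc to a place `q`. -/
inductive PreArc (P : Type*) where
  | weight (k : ℕ) : PreArc P
  | inhibitor : PreArc P
  | reset : PreArc P
  | transfer (q : P) : PreArc P
  deriving DecidableEq

/-- A Petri net with special arcs, with places `P` and transitions `T`. `pre p t` is the arc from
the place `p` to the transition `t`, `post t p` is the weight of the arc from the transition `t`
to the place `p`, and `init` is the initial marking. -/
structure PetriNet (P T : Type*) where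
  pre : P → T → PreArc P
  post : T → P → ℕ
  init : P → ℕ

namespace PetriNet

variable {P T : Type*} [Fintype P] [DecidableEq P] [Fintype T]

/-- `t` is firable at the marking `M`: every ordinary pre-arc finds enough tokens, and every place
with an inhibitor arc to `t` is empty. Reset and transfer arcs impose no condition. -/
def Firable (N : PetriNet P T) (t : T) (M : P → ℕ) : Prop :=
  (∀ p k, N.pre p t = .weight k → k ≤ M p) ∧ (∀ p, N.pre p t = .inhibitor → M p = 0)

/-- The number of tokens of `M` that remain in `p` once `t` has taken tokens away. An ordinary arc
takes its weight, a reset arc and a transfer arc take everything. -/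
def remaining (N : PetriNet P T) (t : T) (M : P → ℕ) (p : P) : ℕ :=
  match N.pre p t with
  | .weight k => M p - k
  | .inhibitor => M p
  | .reset => 0
  | .transfer _ => 0

/-- The marking obtained by firing `t` at `M`: what remains in a place, plus all the tokens of the
places that have a transfer arc through `t` to it, plus what the post-arc of `t` produces. -/
def fire (N : PetriNet P T) (t : T) (M : P → ℕ) (p : P) : ℕ :=
  N.remaining t M p + (∑ q with N.pre q t = .transfer p, M q) + N.post t p

/-- `M'` results from `M` by firing one firable transition. -/
def Step (N : PetriNet P T) (M M' : P → ℕ) : Prop :=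
  ∃ t, N.Firable t M ∧ M' = N.fire t M

/-- `M` is reached by a (finite, possibly empty) run from the initial marking. -/
def Reachable (N : PetriNet P T) (M : P → ℕ) : Prop :=
  Relation.ReflTransGen N.Step N.init M

/-- Some reachable marking is componentwise at least `M`. -/
def Coverable (N : PetriNet P T) (M : P → ℕ) : Prop :=
  ∃ M', M ≤ M' ∧ N.Reachable M'

/-- The number of inhibitor arcs. -/
def numInhibitor (N : PetriNet P T) : ℕ :=
  (Finset.univ.filter fun a : P × T => N.pre a.1 a.2 = .inhibitor).card

/-- The number of reset arcs. -/
def numReset (N : PetriNet P T) : ℕ :=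
  (Finset.univ.filter fun a : P × T => N.pre a.1 a.2 = .reset).card

/-- The number of transfer arcs. -/
def numTransfer (N : PetriNet P T) : ℕ :=
  (Finset.univ.filter fun a : P × T => ∃ q, N.pre a.1 a.2 = .transfer q).card

/-- An arc from a place, written as a pair of natural numbers. -/
def arcCode {n : ℕ} : PreArc (Fin n) → ℕ × ℕ
  | .weight k => (0, k)
  | .inhibitor => (1, 0)
  | .reset => (2, 0)
  | .transfer q => (3, q)

/-- Words that describe instances of the coverability problem. -/
abbrev Code : Type := List (List ((ℕ × ℕ) × ℕ)) × List ℕ × List ℕ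

/-- The explicit description of a net with a target marking: for each transition the row of its
pre-arcs and post-arcs, place by place, then the initial marking, then the target marking. -/
def encode {n m : ℕ} (N : PetriNet (Fin n) (Fin m)) (M : Fin n → ℕ) : Code :=
  (List.ofFn fun t => List.ofFn fun p => (arcCode (N.pre p t), N.post t p),
    List.ofFn N.init, List.ofFn M)

/-- Coverability is decidable for the finite nets of the class `C`: an algorithm, given the explicit
description of a net in `C` and of a target marking, tells whether the marking is coverable.
(Nothing is required of the algorithm on other inputs, except to halt.) -/
def CoverabilityDecidable (C : ∀ n m : ℕ, PetriNet (Fin n) (Fin m) → Prop) : Prop :=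
  ∃ D : Code → Prop, ComputablePred D ∧
    ∀ (n m : ℕ) (N : PetriNet (Fin n) (Fin m)) (M : Fin n → ℕ),
      C n m N → (D (N.encode M) ↔ N.Coverable M)

end PetriNet

/-!
The halting problem is reduced to coverability in one fixed net whose initial marking varies.

A net can test a counter for zero in a weak way, by emptying it with a reset or a transfer arc and
going on. To find out whether the emptied counters were empty before, a place `sum` mirrors the
increments and decrements of the two counters `a` and `b`. Always `a + b ≤ sum`, the difference
never decreases, and it grows exactly when a counter is emptied that was not empty. At the end of
the run `a` is drained together with `sum`, and the inhibitor arc checks that `sum` is then zero: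
this shows that no test has cheated. Hence two counters with unrestricted zero tests are available,
and two arcs that empty a counter suffice for all tests, since the net shares them like subroutines
and keeps the return address in a place of its own (`AffineGraph.coverable_net_iff`).

With two counters the net implements any relation `d * x + r ↦ m * x + s` on a single number stored
in `a`: remove `d` from `a` and add `m` to `b` in a loop, remove `r`, test `a`, move `b` back to
`a`, test `b`, and add `s`. So it simulates finite automata whose edges carry such affine relations.
With the Gödel numbering `v ↦ ∏ i, p i ^ v i`, where `p i` is the `i`-th prime, they simulate
programs on any finite number of registers (`Prog.runs_regCode_iff`, `Prog.exists_affineGraph`).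
These programs compute all primitive recursive functions (`Prog.computes_of_primrec`). Since they
may guess, they also accept the halting problem, by guessing a number of steps and checking it
(`Prog.exists_runs_iff_halts`). The program is fixed; the code `n` of the partial
recursive function is the initial content of the register `0`, so it enters the net only through the
initial marking `2 ^ n` of `a` and of `sum`, and the description of the net is computable from `n`.
-/

open Function

/-! ### Register programs -/

/-- Regular expressions over the actions `α`, read as nondeterministic programs. -/
inductive Prog (α : Type) where
  | skip : Prog α
  | atom (a : α) : Prog α
  | seq (p q : Prog α) : Prog α
  | star (p : Prog α) : Prog α

namespace Prog

/-- `p.Runs I x y`: some run of `p` leads from the state `x` to the state `y`, where the action `a`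
means the relation `I a`. -/
def Runs {α σ : Type} (I : α → σ → σ → Prop) : Prog α → σ → σ → Prop
  | skip, x, y => x = y
  | atom a, x, y => I a x y
  | seq p q, x, z => ∃ y, p.Runs I x y ∧ q.Runs I y z
  | star p, x, y => Relation.ReflTransGen (p.Runs I) x y

end Prog

/-- Instructions on registers indexed by `ℕ`: increment, decrement (blocking at `0`), zero test. -/
inductive Instr where
  | inc (i : ℕ) : Instr
  | dec (i : ℕ) : Instr
  | zero (i : ℕ) : Instr

namespace Instr

/-- The effect of an instruction on the register contents. -/
def Exec : Instr → (ℕ → ℕ) → (ℕ → ℕ) → Prop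
  | inc i, v, w => w = update v i (v i + 1)
  | dec i, v, w => v i ≠ 0 ∧ w = update v i (v i - 1)
  | zero i, v, w => v i = 0 ∧ w = v

end Instr

namespace Prog

/-- From `v`, the program `p` has a terminating run, and all of them end in `w`. -/
def Yields (p : Prog Instr) (v w : ℕ → ℕ) : Prop :=
  ∀ w', p.Runs Instr.Exec v w' ↔ w' = w

theorem yields_skip (v : ℕ → ℕ) : Yields skip v v := fun _ => eq_comm

theorem yields_inc (i : ℕ) (v : ℕ → ℕ) :
    Yields (atom (.inc i)) v (update v i (v i + 1)) := fun _ => Iff.rfl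

theorem Yields.seq {p q : Prog Instr} {u v w : ℕ → ℕ} (hp : Yields p u v) (hq : Yields q v w) :
    Yields (p.seq q) u w := by
  intro w'
  constructor
  · rintro ⟨y, h1, h2⟩
    rw [hp] at h1
    subst h1
    exact (hq _).1 h2
  · rintro rfl
    exact ⟨v, (hp _).2 rfl, (hq _).2 rfl⟩

/-- `while i ≠ 0 do { i := i - 1; p }` -/
def loop (i : ℕ) (p : Prog Instr) : Prog Instr :=
  seq (star (seq (atom (.dec i)) p)) (atom (.zero i))

/-- The rule for loops: `φ c` is the state in which the loop has `c` rounds to go. -/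
theorem yields_loop {i : ℕ} {p : Prog Instr} (φ : ℕ → ℕ → ℕ) (n : ℕ) (hi : ∀ c ≤ n, φ c i = c)
    (h : ∀ c < n, Yields p (update (φ (c + 1)) i c) (φ c)) : Yields (loop i p) (φ n) (φ 0) := by
  induction n with
  | zero =>
    intro w'
    constructor
    · rintro ⟨y, h1, h2, rfl⟩
      rcases h1.cases_head with h1 | ⟨z, ⟨u, ⟨hu, -⟩, -⟩, -⟩
      · exact h1.symm
      · exact absurd (hi 0 le_rfl) hu
    · rintro rfl
      exact ⟨φ 0, .refl, hi 0 le_rfl, rfl⟩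
  | succ n ih =>
    have ih := ih (fun c hc => hi c (by omega)) (fun c hc => h c (by omega))
    have hn := hi (n + 1) le_rfl
    intro w'
    constructor
    · rintro ⟨y, h1, h2, rfl⟩
      rcases h1.cases_head with h1 | ⟨z, ⟨u, ⟨-, hu⟩, hz⟩, h3⟩
      · rw [← h1, hn] at h2
        exact absurd h2 n.succ_ne_zero
      · rw [hn, Nat.add_sub_cancel] at hu
        rw [hu, h n (by omega)] at hz
        subst hz
        exact (ih _).1 ⟨_, h3, h2, rfl⟩
    · rintro rfl
      obtain ⟨y, h1, h2⟩ := (ih _).2 rfl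
      refine ⟨y, .head ⟨_, ⟨?_, rfl⟩, ?_⟩ h1, h2⟩
      · rw [hn]
        exact n.succ_ne_zero
      · rw [hn, Nat.add_sub_cancel, h n (by omega)]

/-- `i := 0` -/
def clear (i : ℕ) : Prog Instr := loop i skip

/-- `j := j + i; i := 0` -/
def move (i j : ℕ) : Prog Instr := loop i (atom (.inc j))

/-- `j := j + i`, with the help of a register `t` that is empty before and after. -/
def copy (i j t : ℕ) : Prog Instr :=
  seq (loop i (seq (atom (.inc j)) (atom (.inc t)))) (move t i)

theorem yields_clear (i : ℕ) (v : ℕ → ℕ) : Yields (clear i) v (update v i 0) := by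
  have := yields_loop (i := i) (p := skip) (fun c => update v i c) (v i) (by simp)
    (fun c _ => by simpa using yields_skip _)
  simpa [clear] using this

theorem yields_move {i j : ℕ} (hij : i ≠ j) (v : ℕ → ℕ) :
    Yields (move i j) v (update (update v j (v j + v i)) i 0) := by
  have := yields_loop (i := i) (p := atom (.inc j))
    (fun c => update (update v j (v j + (v i - c))) i c) (v i) (by simp)
    (fun c hc => by
      convert yields_inc j _ using 1
      funext k
      simp only [update_apply]
      split_ifs <;> omega)
  simpa [move] using this

theorem yields_copy {i j t : ℕ} (hij : i ≠ j) (hit : i ≠ t) (hjt : j ≠ t) (v : ℕ → ℕ)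
    (ht : v t = 0) : Yields (copy i j t) v (update v j (v j + v i)) := by
  have h1 := yields_loop (i := i) (p := seq (atom (.inc j)) (atom (.inc t)))
    (fun c => update (update (update v j (v j + (v i - c))) t (v i - c)) i c) (v i) (by simp)
    (fun c hc => by
      convert (yields_inc j _).seq (yields_inc t _) using 1
      funext k
      simp only [update_apply]
      split_ifs <;> omega)
  have h2 : Yields (loop i (seq (atom (.inc j)) (atom (.inc t)))) v
      (update (update (update v j (v j + v i)) t (v i)) i 0) := by
    simp only [Nat.sub_self, Nat.sub_zero, Nat.add_zero, update_eq_self] at h1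
    have h0 : update v t 0 = v := by rw [← ht, update_eq_self]
    rwa [h0, update_eq_self] at h1
  have h3 : Yields (copy i j t) v _ := h2.seq (yields_move (Ne.symm hit) _)
  convert h3 using 1
  funext k
  simp only [update_apply]
  split_ifs <;> simp_all

/-! ### Primitive recursive functions -/

/-- Programs compute `f`: from any input registers into any other register `out` that is empty,
given that all registers from `m` on are empty and free to use. -/
def Computes {n : ℕ} (f : List.Vector ℕ n → ℕ) : Prop :=
  ∀ (ins : Fin n → ℕ) (out m : ℕ), (∀ i, ins i < m) → (∀ i, ins i ≠ out) → out < m →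
    ∃ p : Prog Instr, ∀ v : ℕ → ℕ, v out = 0 → (∀ j, m ≤ j → v j = 0) →
      Yields p v (update v out (f (List.Vector.ofFn fun i => v (ins i))))

theorem computes_get {n : ℕ} (i : Fin n) : Computes fun v : List.Vector ℕ n => v.get i := by
  intro ins out m hins hout hm
  refine ⟨copy (ins i) out m, fun v hv hj => ?_⟩
  convert yields_copy (hout i) (hins i).ne hm.ne v (hj m le_rfl) using 1
  simp [hv]

theorem computes_succ : Computes fun v : List.Vector ℕ 1 => v.head.succ := by
  intro ins out m hins hout hm
  obtain ⟨p, hp⟩ := computes_get (0 : Fin 1) ins out m hins hout hm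
  refine ⟨p.seq (atom (.inc out)), fun v hv hj => ?_⟩
  convert (hp v hv hj).seq (yields_inc out _) using 1
  simp [← List.Vector.get_zero]

/-- Clearing the `k` registers from `m` on. -/
theorem exists_yields_clear_block (m k : ℕ) : ∃ p : Prog Instr, ∀ v : ℕ → ℕ,
    Yields p v (fun j => if m ≤ j ∧ j < m + k then 0 else v j) := by
  induction k with
  | zero =>
    refine ⟨skip, fun v => ?_⟩
    convert yields_skip v using 1
    funext j
    rw [if_neg (by omega)]
  | succ k ih =>
    obtain ⟨p, hp⟩ := ih
    refine ⟨p.seq (clear (m + k)), fun v => ?_⟩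
    convert (hp v).seq (yields_clear (m + k) _) using 1
    funext j
    simp only [update_apply]
    split_ifs <;> first | rfl | omega

theorem Computes.comp {m n : ℕ} {f : List.Vector ℕ n → ℕ} (g : Fin n → List.Vector ℕ m → ℕ)
    (hf : Computes f) (hg : ∀ i, Computes (g i)) :
    Computes fun a => f (List.Vector.ofFn fun i => g i a) := by
  intro ins out b hins hout hb
  -- the values of the `g i` go to the registers `b + i`
  have key : ∀ k ≤ n, ∃ p : Prog Instr, ∀ v : ℕ → ℕ, v out = 0 → (∀ j, b ≤ j → v j = 0) →
      Yields p v (fun j => if h : b ≤ j ∧ j < b + k ∧ j - b < n then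
        g ⟨j - b, h.2.2⟩ (List.Vector.ofFn fun i => v (ins i)) else v j) := by
    intro k
    induction k with
    | zero =>
      refine fun _ => ⟨skip, fun v _ _ => ?_⟩
      convert yields_skip v using 1
      funext j
      rw [dif_neg (by omega)]
    | succ k ih =>
      intro hk
      obtain ⟨p, hp⟩ := ih (by omega)
      obtain ⟨q, hq⟩ := hg ⟨k, hk⟩ ins (b + k) (b + n) (fun i => by have := hins i; omega)
        (fun i => by have := hins i; omega) (by omega)
      refine ⟨p.seq q, fun v h0 hv => ?_⟩
      convert (hp v h0 hv).seq (hq _ ?_ ?_) using 1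
      · funext j
        rcases eq_or_ne j (b + k) with rfl | hj
        · rw [dif_pos (by omega)]
          simp only [update_self, Nat.add_sub_cancel_left]
          congr 2
          funext i
          rw [dif_neg (by have := hins i; omega)]
        · rw [update_of_ne hj]
          by_cases h : b ≤ j ∧ j < b + k ∧ j - b < n
          · rw [dif_pos h, dif_pos (by omega)]
          · rw [dif_neg h, dif_neg (by omega)]
      · simp [hv]
      · intro j hj
        rw [dif_neg (by omega)]
        exact hv j (by omega)
  obtain ⟨p, hp⟩ := key n le_rfl
  obtain ⟨q, hq⟩ := hf (fun i => b + i) out (b + n) (fun i => by omega) (fun i => by omega)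
    (by omega)
  obtain ⟨r, hr⟩ := exists_yields_clear_block b n
  refine ⟨(p.seq q).seq r, fun v h0 hv => ?_⟩
  convert ((hp v h0 hv).seq (hq _ ?_ ?_)).seq (hr _) using 1
  · funext j
    rcases eq_or_ne j out with rfl | hj
    · rw [if_neg (by omega), update_self, update_self]
      refine congrArg f (congrArg _ (funext fun i => ?_))
      rw [dif_pos (by omega)]
      simp
    · rw [update_of_ne hj, update_of_ne hj]
      split_ifs
      · exact hv j (by omega)
      · omega
      · rfl
  · rw [dif_neg (by omega)]
    exact h0
  · intro j hj
    rw [dif_neg (by omega)]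
    exact hv j (by omega)

theorem Computes.prec {n : ℕ} {f : List.Vector ℕ n → ℕ} {g : List.Vector ℕ (n + 2) → ℕ}
    (hf : Computes f) (hg : Computes g) :
    Computes fun v : List.Vector ℕ (n + 1) =>
      v.head.rec (f v.tail) fun y IH => g (y ::ᵥ IH ::ᵥ v.tail) := by
  intro ins out m hins hout hm
  -- `m` counts the remaining rounds, `m + 1` the completed ones, `m + 2` receives the new value
  obtain ⟨p, hp⟩ := hf (fun i => ins i.succ) out (m + 3) (fun i => by have := hins i.succ; omega)
    (fun i => hout _) (by omega)
  obtain ⟨q, hq⟩ := hg (Fin.cons (m + 1) (Fin.cons out fun i => ins i.succ)) (m + 2) (m + 3)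
    (by
      refine Fin.cases (by simp) (Fin.cases (by simp; omega) fun i => ?_)
      have := hins i.succ
      simp; omega)
    (by
      refine Fin.cases (by simp) (Fin.cases (by simp; omega) fun i => ?_)
      have := hins i.succ
      simp; omega)
    (by omega)
  have h0 := hins 0
  refine ⟨(((copy (ins 0) m (m + 1)).seq p).seq (loop m
    (((q.seq (clear out)).seq (move (m + 2) out)).seq (atom (.inc (m + 1)))))).seq
    (clear (m + 1)), fun v hout0 hv => ?_⟩
  · set F : ℕ → ℕ := fun c => Nat.rec (f (.ofFn fun i => v (ins i.succ)))
      (fun y IH => g (y ::ᵥ IH ::ᵥ .ofFn fun i => v (ins i.succ))) c with hF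
    have hcopy := yields_copy (i := ins 0) (j := m) (t := m + 1) h0.ne (by omega) (by omega) v
      (hv _ (by omega))
    have hbase := hp (update v m (v m + v (ins 0)))
      (by rw [update_of_ne (by omega), hout0])
      (fun j hj => by rw [update_of_ne (by omega), hv j (by omega)])
    have hround := yields_loop (i := m)
      (p := ((q.seq (clear out)).seq (move (m + 2) out)).seq
        (atom (.inc (m + 1))))
      (fun c => update (update (update v out (F (v (ins 0) - c))) (m + 1) (v (ins 0) - c)) m c)
      (v (ins 0)) (by simp) (fun c hc => by
        convert (((hq _ ?_ ?_).seq (yields_clear out _)).seq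
          (yields_move (i := m + 2) (j := out) (by omega) _)).seq (yields_inc (m + 1) _) using 1
        · have hFc : F (v (ins 0) - c) = g (List.Vector.ofFn fun i =>
              update (update (update (update v out (F (v (ins 0) - (c + 1)))) (m + 1)
              (v (ins 0) - (c + 1))) m (c + 1)) m c
              ((Fin.cons (m + 1) (Fin.cons out fun i => ins i.succ) : Fin (n + 2) → ℕ) i)) := by
            have hc' : v (ins 0) - c = (v (ins 0) - (c + 1)) + 1 := by omega
            rw [hc']
            simp only [List.Vector.ofFn, Fin.cons_zero, Fin.cons_succ]
            change g _ = g _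
            congr 3
            · simp
            · simp [hm.ne, show out ≠ m + 1 by omega, hF]
            · refine congrArg _ (funext fun i => ?_)
              have h1 := hins i.succ
              have h2 := hout i.succ
              simp [h1.ne, h2, show ins i.succ ≠ m + 1 by omega]
          rw [← hFc]
          funext j
          simp only [update_apply]
          split_ifs <;> first | omega | simp_all
        · simp [hv, show m + 2 ≠ out by omega]
        · intro j hj
          simp [show j ≠ m by omega, show j ≠ m + 1 by omega,
            show j ≠ out by omega, hv j (by omega)])
    have hstart : Yields ((copy (ins 0) m (m + 1)).seq p) v
        (update (update (update v out (F (v (ins 0) - v (ins 0)))) (m + 1)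
          (v (ins 0) - v (ins 0))) m (v (ins 0))) := by
      convert hcopy.seq hbase using 1
      have hF0 : F 0 = f (List.Vector.ofFn fun i =>
          update v m (v m + v (ins 0)) (ins i.succ)) := by
        refine congrArg f (congrArg _ (funext fun i => ?_))
        rw [update_of_ne (hins _).ne]
      rw [← hF0, Nat.sub_self]
      funext j
      have h1 := hv m le_rfl
      have h2 := hv (m + 1) (by omega)
      simp only [update_apply]
      split_ifs <;> first | omega | simp_all
    convert (hstart.seq hround).seq (yields_clear (m + 1) _) using 1
    have hFv : F (v (ins 0)) = (fun v : List.Vector ℕ (n + 1) =>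
        (v.head.rec (f v.tail) fun y IH => g (y ::ᵥ IH ::ᵥ v.tail) : ℕ))
        (List.Vector.ofFn fun i => v (ins i)) := by
      simp [hF, List.Vector.ofFn]
    rw [← hFv, Nat.sub_zero]
    funext j
    have h1 := hv m le_rfl
    have h2 := hv (m + 1) (by omega)
    simp only [update_apply]
    split_ifs <;> first | omega | simp_all

theorem computes_of_primrec {n : ℕ} {f : List.Vector ℕ n → ℕ} (hf : Nat.Primrec' f) :
    Computes f := by
  induction hf with
  | zero =>
    intro ins out m _ _ _
    exact ⟨skip, fun v hv _ => by
      convert yields_skip v using 1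
      rw [update_eq_iff]
      simp [hv]⟩
  | succ => exact computes_succ
  | get i => exact computes_get i
  | comp g _ _ hf hg => exact hf.comp g hg
  | prec _ _ hf hg => exact hf.prec hg

end Prog

/-! ### The halting problem -/

namespace Prog

/-- There is a program that terminates, for suitable choices, exactly on the codes of the
partial recursive functions that are defined at `0`. It guesses a number of computation steps in
the register `1` and checks the guess. -/
theorem exists_runs_iff_halts : ∃ p : Prog Instr, ∀ n : ℕ,
    (∃ w, p.Runs Instr.Exec (update 0 0 n) w) ↔
      (Nat.Partrec.Code.eval (Denumerable.ofNat Nat.Partrec.Code n) 0).Dom := by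
  let g : List.Vector ℕ 2 → ℕ := fun v =>
    bif (Nat.Partrec.Code.evaln (v.get 1) (Denumerable.ofNat Nat.Partrec.Code (v.get 0)) 0).isSome
      then 0 else 1
  have hg : Primrec g := by
    refine Primrec.cond (Primrec.option_isSome.comp
      (Nat.Partrec.Code.primrec_evaln.comp (.pair (.pair ?_ ?_) (.const 0)))) (.const 0) (.const 1)
    · exact Primrec.vector_get.comp .id (.const 1)
    · exact (Primrec.ofNat _).comp (Primrec.vector_get.comp .id (.const 0))
  obtain ⟨p, hp⟩ := computes_of_primrec (Nat.Primrec'.of_prim hg) (fun i => i) 2 3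
    (fun i => by omega) (fun i => by omega) (by omega)
  have hguess : ∀ (n : ℕ) (v : ℕ → ℕ), (star (atom (.inc 1))).Runs Instr.Exec (update 0 0 n) v ↔
      ∃ k, v = update (update (0 : ℕ → ℕ) 0 n) 1 k := by
    intro n v
    constructor
    · intro h
      induction h with
      | refl => exact ⟨0, by simp⟩
      | tail _ h ih =>
        obtain ⟨k, rfl⟩ := ih
        exact ⟨k + 1, by simpa [Runs, Instr.Exec] using h⟩
    · rintro ⟨k, rfl⟩
      induction k with
      | zero =>
        rw [show update (update (0 : ℕ → ℕ) 0 n) 1 0 = update (0 : ℕ → ℕ) 0 n by simp]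
        exact Relation.ReflTransGen.refl
      | succ k ih => exact ih.tail (by simp [Runs, Instr.Exec])
  refine ⟨((star (atom (.inc 1))).seq p).seq (atom (.zero 2)), fun n => ?_⟩
  have hrun : ∀ k, Yields p (update (update (0 : ℕ → ℕ) 0 n) 1 k)
      (update (update (update (0 : ℕ → ℕ) 0 n) 1 k) 2 (g (n ::ᵥ k ::ᵥ .nil))) := by
    intro k
    convert hp (update (update (0 : ℕ → ℕ) 0 n) 1 k) (by simp) (fun j hj => by
      simp [show j ≠ 0 by omega, show j ≠ 1 by omega]) using 2
    refine congrArg g (List.Vector.ext fun i => ?_)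
    fin_cases i
    · simp
    · simp only [Fin.mk_one, List.Vector.get_ofFn]
      exact (update_self 1 k (update (0 : ℕ → ℕ) 0 n)).symm
  have hdom : (Nat.Partrec.Code.eval (Denumerable.ofNat Nat.Partrec.Code n) 0).Dom ↔
      ∃ k, g (n ::ᵥ k ::ᵥ .nil) = 0 := by
    have hgk : ∀ k, g (n ::ᵥ k ::ᵥ .nil) = 0 ↔
        (Nat.Partrec.Code.evaln k (Denumerable.ofNat Nat.Partrec.Code n) 0).isSome := by
      intro k
      simp only [g, List.Vector.get_zero, List.Vector.head_cons]
      change (bif (Nat.Partrec.Code.evaln k _ 0).isSome then 0 else 1) = 0 ↔ _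
      cases (Nat.Partrec.Code.evaln k (Denumerable.ofNat Nat.Partrec.Code n) 0).isSome <;> simp
    simp only [hgk, Part.dom_iff_mem, Nat.Partrec.Code.evaln_complete, Option.isSome_iff_exists]
    exact exists_comm
  rw [hdom]
  constructor
  · rintro ⟨w, v, ⟨u, hu, hv⟩, h0, -⟩
    obtain ⟨k, rfl⟩ := (hguess n u).1 hu
    rw [hrun] at hv
    subst hv
    exact ⟨k, by simpa using h0⟩
  · rintro ⟨k, hk⟩
    have h0 : Instr.Exec (.zero 2) (update (update (update (0 : ℕ → ℕ) 0 n) 1 k) 2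
        (g (n ::ᵥ k ::ᵥ .nil))) _ := ⟨by simpa using hk, rfl⟩
    exact ⟨_, _, ⟨_, (hguess n _).2 ⟨k, rfl⟩, (hrun k _).2 rfl⟩, h0⟩

end Prog

/-! ### Gödel numbers of register contents -/

/-- The relation on `ℕ` that consists of the pairs `(d * x + r, m * x + s)`. -/
structure Affine where
  (d r m s : ℕ)

namespace Affine

/-- The relation on `ℕ` that `ℓ` stands for. -/
def Rel (ℓ : Affine) (N N' : ℕ) : Prop := ∃ x, N = ℓ.d * x + ℓ.r ∧ N' = ℓ.m * x + ℓ.s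

/-- The identity relation. -/
protected def id : Affine := ⟨1, 0, 1, 0⟩

@[simp] theorem rel_id {N N' : ℕ} : Affine.id.Rel N N' ↔ N = N' := by
  simp [Rel, Affine.id, eq_comm]

end Affine

/-- The Gödel number of the contents of the registers below `K`. -/
noncomputable def regCode (K : ℕ) (v : ℕ → ℕ) : ℕ :=
  ∏ i ∈ Finset.range K, Nat.nth Nat.Prime i ^ v i

theorem regCode_update_succ {K i : ℕ} (hi : i < K) (v : ℕ → ℕ) (c : ℕ) :
    regCode K (update v i (c + 1)) = Nat.nth Nat.Prime i * regCode K (update v i c) := by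
  have hi := Finset.mem_range.2 hi
  have hcongr : ∀ c, ∏ j ∈ (Finset.range K).erase i, Nat.nth Nat.Prime j ^ update v i c j =
      ∏ j ∈ (Finset.range K).erase i, Nat.nth Nat.Prime j ^ v j := fun c =>
    Finset.prod_congr rfl fun j hj => by rw [update_of_ne (Finset.ne_of_mem_erase hj)]
  rw [regCode, regCode, ← Finset.mul_prod_erase _ _ hi, ← Finset.mul_prod_erase _ _ hi, hcongr,
    hcongr, update_self, update_self, pow_succ']
  ring

theorem dvd_regCode_iff {K i : ℕ} (hi : i < K) (v : ℕ → ℕ) :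
    Nat.nth Nat.Prime i ∣ regCode K v ↔ v i ≠ 0 := by
  rw [regCode, (Nat.prime_nth_prime i).prime.dvd_finsetProd_iff]
  constructor
  · rintro ⟨j, -, h⟩ h0
    have h := (Nat.prime_nth_prime i).dvd_of_dvd_pow h
    rw [Nat.prime_dvd_prime_iff_eq (Nat.prime_nth_prime i) (Nat.prime_nth_prime j)] at h
    obtain rfl := Nat.nth_injective Nat.infinite_setOfPred_prime h
    rw [h0, pow_zero] at *
    rename_i h'
    exact (Nat.prime_nth_prime i).one_lt.ne' (Nat.dvd_one.1 h')
  · exact fun h => ⟨i, Finset.mem_range.2 hi, dvd_pow_self _ h⟩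

theorem regCode_update_zero {K n : ℕ} (hK : 0 < K) : regCode K (update 0 0 n) = 2 ^ n := by
  rw [regCode, Finset.prod_eq_single 0]
  · simp [Nat.nth_prime_zero_eq_two]
  · intro j _ hj
    simp [hj]
  · intro h
    simp [hK] at h

namespace Instr

/-- The affine relations whose union is the effect of an instruction on Gödel numbers. A zero test
leaves the number as it is, and has one case for each possible nonzero remainder. -/
noncomputable def labels : Instr → List Affine
  | inc i => [⟨1, 0, Nat.nth Nat.Prime i, 0⟩]
  | dec i => [⟨Nat.nth Nat.Prime i, 0, 1, 0⟩]
  | zero i => (List.range (Nat.nth Nat.Prime i - 1)).map fun r =>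
      ⟨Nat.nth Nat.Prime i, r + 1, Nat.nth Nat.Prime i, r + 1⟩

/-- The effect of an instruction on Gödel numbers. -/
def ExecCode (a : Instr) (N N' : ℕ) : Prop := ∃ ℓ ∈ a.labels, ℓ.Rel N N'

/-- The register of an instruction. -/
def reg : Instr → ℕ
  | inc i => i
  | dec i => i
  | zero i => i

theorem execCode_regCode_iff {K : ℕ} {a : Instr} (h : a.reg < K) (v : ℕ → ℕ) (N : ℕ) :
    a.ExecCode (regCode K v) N ↔ ∃ w, a.Exec v w ∧ N = regCode K w := by
  cases a with
  | inc i =>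
    have := regCode_update_succ (K := K) (i := i) h v (v i)
    simp [ExecCode, labels, Affine.Rel, Exec, this]
  | dec i =>
    have hi : i < K := h
    simp only [ExecCode, labels, Affine.Rel, Exec, List.mem_singleton, exists_eq_left, one_mul,
      add_zero, and_assoc]
    constructor
    · rintro ⟨x, hx, rfl⟩
      have h0 := (dvd_regCode_iff hi v).1 (Dvd.intro _ hx.symm)
      refine ⟨_, h0, rfl, ?_⟩
      have := regCode_update_succ (K := K) (i := i) h v (v i - 1)
      rw [Nat.sub_add_cancel (Nat.pos_of_ne_zero h0), update_eq_self, hx] at this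
      exact Nat.eq_of_mul_eq_mul_left (Nat.prime_nth_prime i).pos this
    · rintro ⟨w, h0, rfl, rfl⟩
      have := regCode_update_succ (K := K) (i := i) h v (v i - 1)
      rw [Nat.sub_add_cancel (Nat.pos_of_ne_zero h0), update_eq_self] at this
      exact ⟨_, this, rfl⟩
  | zero i =>
    have hi : i < K := h
    have hp := (Nat.prime_nth_prime i).pos
    have hdvd := dvd_regCode_iff hi v
    simp only [ExecCode, labels, Affine.Rel, Exec, List.mem_map, List.mem_range]
    constructor
    · rintro ⟨ℓ, ⟨r, hr, rfl⟩, x, hx, rfl⟩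
      refine ⟨v, ⟨?_, rfl⟩, hx.symm⟩
      by_contra h0
      rw [← ne_eq, ← hdvd, hx] at h0
      have := Nat.le_of_dvd (Nat.succ_pos _) ((Nat.dvd_add_right (dvd_mul_right _ _)).1 h0)
      omega
    · rintro ⟨w, ⟨h0, rfl⟩, rfl⟩
      have hmod : regCode K w % Nat.nth Nat.Prime i ≠ 0 := fun h =>
        hdvd.1 (Nat.dvd_of_mod_eq_zero h) h0
      have hlt := Nat.mod_lt (regCode K w) hp
      have hdiv := Nat.div_add_mod (regCode K w) (Nat.nth Nat.Prime i)
      refine ⟨_, ⟨regCode K w % Nat.nth Nat.Prime i - 1, by omega, rfl⟩,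
        regCode K w / Nat.nth Nat.Prime i, ?_, ?_⟩ <;> simp only <;> omega

end Instr

namespace Prog

/-- A bound above all registers that occur in a program. -/
def regBound : Prog Instr → ℕ
  | skip => 0
  | atom a => a.reg + 1
  | seq p q => max p.regBound q.regBound
  | star p => p.regBound

/-- Programs act on Gödel numbers as they do on registers. -/
theorem runs_regCode_iff {K : ℕ} (p : Prog Instr) (hp : p.regBound ≤ K) (v : ℕ → ℕ) (N : ℕ) :
    p.Runs Instr.ExecCode (regCode K v) N ↔ ∃ w, p.Runs Instr.Exec v w ∧ N = regCode K w := by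
  induction p generalizing v N with
  | skip => simp [Runs, eq_comm]
  | atom a => exact Instr.execCode_regCode_iff hp v N
  | seq p q ihp ihq =>
    have ihp := ihp ((le_max_left _ _).trans hp)
    have ihq := ihq ((le_max_right _ _).trans hp)
    constructor
    · rintro ⟨y, h1, h2⟩
      obtain ⟨w, hw, rfl⟩ := (ihp _ _).1 h1
      obtain ⟨u, hu, rfl⟩ := (ihq _ _).1 h2
      exact ⟨u, ⟨w, hw, hu⟩, rfl⟩
    · rintro ⟨u, ⟨w, hw, hu⟩, rfl⟩
      exact ⟨_, (ihp _ _).2 ⟨w, hw, rfl⟩, (ihq _ _).2 ⟨u, hu, rfl⟩⟩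
  | star p ihp =>
    have ihp := ihp hp
    constructor
    · intro h
      change Relation.ReflTransGen _ _ _ at h
      induction h with
      | refl => exact ⟨v, .refl, rfl⟩
      | tail _ h ih =>
        obtain ⟨w, hw, rfl⟩ := ih
        obtain ⟨u, hu, rfl⟩ := (ihp _ _).1 h
        exact ⟨u, .tail hw hu, rfl⟩
    · rintro ⟨w, h, rfl⟩
      change Relation.ReflTransGen _ _ _ at h
      induction h with
      | refl => exact .refl
      | tail _ h ih => exact .tail ih ((ihp _ _).2 ⟨_, h, rfl⟩)

end Prog

/-! ### Automata with affine edges -/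

/-- A finite automaton over one natural number: each edge `e` leads from the state `src e` to the
state `tgt e` and changes the number by the relation `label e`. -/
structure AffineGraph (Q E : Type) where
  src : E → Q
  tgt : E → Q
  label : E → Affine

/-- The passage along one edge. -/
def AffineGraph.Step {Q E : Type} (G : AffineGraph Q E) (c c' : Q × ℕ) : Prop :=
  ∃ e, c.1 = G.src e ∧ c'.1 = G.tgt e ∧ (G.label e).Rel c.2 c'.2

namespace Prog

/-- A list of programs, to be run one after the other, is a control state; its successors are
obtained by unfolding the first program, or by executing it if it is an instruction. -/
noncomputable def succs : List (Prog Instr) → List (Affine × List (Prog Instr))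
  | [] => []
  | skip :: k => [(.id, k)]
  | atom a :: k => a.labels.map fun ℓ => (ℓ, k)
  | seq p q :: k => [(.id, p :: q :: k)]
  | star p :: k => [(.id, k), (.id, p :: star p :: k)]

/-- The finitely many control states that are met in runs of `p` with continuation `k`, apart from
`k` itself. -/
def conts : Prog Instr → List (Prog Instr) → Set (List (Prog Instr))
  | skip, k => {skip :: k}
  | atom a, k => {atom a :: k}
  | seq p q, k => insert (seq p q :: k) (conts p (q :: k) ∪ conts q k)
  | star p, k => insert (star p :: k) (conts p (star p :: k))

theorem finite_conts (p : Prog Instr) (k : List (Prog Instr)) : (conts p k).Finite := by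
  induction p generalizing k with
  | skip => exact Set.finite_singleton _
  | atom a => exact Set.finite_singleton _
  | seq p q ihp ihq => exact ((ihp _).union (ihq _)).insert _
  | star p ihp => exact (ihp _).insert _

theorem cons_mem_conts (p : Prog Instr) (k : List (Prog Instr)) : p :: k ∈ conts p k := by
  cases p <;> simp [conts]

theorem mem_conts_of_mem_succs {p : Prog Instr} {k l l' : List (Prog Instr)} {ℓ : Affine}
    (hl : l ∈ conts p k) (h : (ℓ, l') ∈ succs l) : l' = k ∨ l' ∈ conts p k := by
  induction p generalizing k with
  | skip =>
    obtain rfl : l = _ := hl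
    simp_all [succs]
  | atom a =>
    obtain rfl : l = _ := hl
    simp_all [succs]
  | seq p q ihp ihq =>
    rcases hl with rfl | hl | hl
    · right
      simp only [succs, List.mem_singleton, Prod.mk.injEq] at h
      rw [h.2]
      exact .inr (.inl (cons_mem_conts _ _))
    · rcases ihp hl with rfl | h
      · exact .inr (.inr (.inr (cons_mem_conts _ _)))
      · exact .inr (.inr (.inl h))
    · exact (ihq hl).imp_right fun h => .inr (.inr h)
  | star p ihp =>
    rcases hl with rfl | hl
    · simp only [succs, List.mem_cons, List.not_mem_nil, or_false, Prod.mk.injEq] at h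
      rcases h with h | h
      · exact .inl h.2
      · rw [h.2]
        exact .inr (.inr (cons_mem_conts _ _))
    · rcases ihp hl with rfl | h
      · exact .inr (.inl rfl)
      · exact .inr (.inr h)

/-- The effect of a list of programs on Gödel numbers. -/
def RunsList : List (Prog Instr) → ℕ → ℕ → Prop
  | [], N, N' => N = N'
  | p :: k, N, N' => ∃ x, p.Runs Instr.ExecCode N x ∧ RunsList k x N'

theorem RunsList.of_mem_succs {k k' : List (Prog Instr)} {ℓ : Affine} {N x N' : ℕ}
    (h : (ℓ, k') ∈ succs k) (hℓ : ℓ.Rel N x) (hk : RunsList k' x N') : RunsList k N N' := by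
  match k with
  | [] => simp [succs] at h
  | skip :: k =>
    simp only [succs, List.mem_singleton, Prod.mk.injEq] at h
    obtain ⟨rfl, rfl⟩ := h
    exact ⟨x, Affine.rel_id.1 hℓ, hk⟩
  | atom a :: k =>
    simp only [succs, List.mem_map, Prod.mk.injEq] at h
    obtain ⟨ℓ, h, rfl, rfl⟩ := h
    exact ⟨x, ⟨ℓ, h, hℓ⟩, hk⟩
  | seq p q :: k =>
    simp only [succs, List.mem_singleton, Prod.mk.injEq] at h
    obtain ⟨rfl, rfl⟩ := h
    obtain rfl := Affine.rel_id.1 hℓ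
    obtain ⟨y, hy, z, hz, h⟩ := hk
    exact ⟨z, ⟨y, hy, hz⟩, h⟩
  | star p :: k =>
    simp only [succs, List.mem_cons, List.not_mem_nil, or_false, Prod.mk.injEq] at h
    rcases h with ⟨rfl, rfl⟩ | ⟨rfl, rfl⟩
    · obtain rfl := Affine.rel_id.1 hℓ
      exact ⟨N, .refl, hk⟩
    · obtain rfl := Affine.rel_id.1 hℓ
      obtain ⟨y, hy, z, hz, h⟩ := hk
      exact ⟨z, .head hy hz, h⟩

/-- The automaton on a set of control states that is closed under successors. -/
def contGraph (S : Set (List (Prog Instr)))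
    (hS : ∀ k ∈ S, ∀ x ∈ succs k, x.2 ∈ S) :
    AffineGraph S (Σ k : S, {x : Affine × List (Prog Instr) | x ∈ succs k}) where
  src e := e.1
  tgt e := ⟨e.2.1.2, hS _ e.1.2 _ e.2.2⟩
  label e := e.2.1.1

theorem contGraph_step {S : Set (List (Prog Instr))} {hS : ∀ k ∈ S, ∀ x ∈ succs k, x.2 ∈ S}
    {k k' : S} {N N' : ℕ} {ℓ : Affine} (h : (ℓ, k'.1) ∈ succs k) (hℓ : ℓ.Rel N N') :
    (contGraph S hS).Step (k, N) (k', N') :=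
  ⟨⟨k, ⟨_, h⟩⟩, rfl, rfl, hℓ⟩

theorem Runs.reflTransGen_contGraph {S : Set (List (Prog Instr))}
    {hS : ∀ k ∈ S, ∀ x ∈ succs k, x.2 ∈ S} {p : Prog Instr} {N N' : ℕ}
    (h : p.Runs Instr.ExecCode N N') {k : List (Prog Instr)} (hk : k ∈ S) (hpk : p :: k ∈ S)
    (hp : conts p k ⊆ S) :
    Relation.ReflTransGen (contGraph S hS).Step (⟨p :: k, hpk⟩, N) (⟨k, hk⟩, N') := by
  induction p generalizing N N' k with
  | skip => exact .single (contGraph_step (by simp [succs]) (Affine.rel_id.2 h))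
  | atom a =>
    obtain ⟨ℓ, hℓ, h⟩ := h
    exact .single (contGraph_step (by simpa [succs] using hℓ) h)
  | seq p q ihp ihq =>
    obtain ⟨x, h1, h2⟩ := h
    have hp1 : conts p (q :: k) ⊆ S := fun y hy => hp (.inr (.inl hy))
    have hq1 : conts q k ⊆ S := fun y hy => hp (.inr (.inr hy))
    have hqk := hq1 (cons_mem_conts _ _)
    exact .head (contGraph_step (k' := ⟨_, hp1 (cons_mem_conts _ _)⟩) (by simp [succs])
      (Affine.rel_id.2 rfl)) ((ihp h1 hqk _ hp1).trans (ihq h2 hk hqk hq1))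
  | star p ihp =>
    have hp1 : conts p (star p :: k) ⊆ S := fun y hy => hp (.inr hy)
    have hpk1 := hp1 (cons_mem_conts _ _)
    have hend : ∀ x, (contGraph S hS).Step (⟨star p :: k, hpk⟩, x) (⟨k, hk⟩, x) := fun x =>
      contGraph_step (by simp [succs]) (Affine.rel_id.2 rfl)
    change Relation.ReflTransGen _ _ _ at h
    induction h using Relation.ReflTransGen.head_induction_on with
    | refl => exact .single (hend _)
    | head h _ ih =>
      exact .head (contGraph_step (k' := ⟨_, hpk1⟩) (by simp [succs]) (Affine.rel_id.2 rfl))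
        ((ihp h hpk hpk1 hp1).trans ih)

theorem exists_affineGraph (p : Prog Instr) : ∃ (Q E : Type) (_ : Finite Q) (_ : Finite E)
    (G : AffineGraph Q E) (q₀ q₁ : Q), ∀ N N',
      Relation.ReflTransGen G.Step (q₀, N) (q₁, N') ↔ p.Runs Instr.ExecCode N N' := by
  let S : Set (List (Prog Instr)) := insert [] (conts p [])
  have hS : ∀ k ∈ S, ∀ x ∈ succs k, x.2 ∈ S := by
    rintro k (rfl | hk) ⟨ℓ, l⟩ hx
    · simp [succs] at hx
    · exact mem_conts_of_mem_succs hk hx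
  have hfin : Finite S := ((finite_conts p []).insert []).to_subtype
  have hfinE : ∀ k : S, Finite {x : Affine × List (Prog Instr) | x ∈ succs k} := fun k =>
    (List.finite_toSet (succs k)).to_subtype
  refine ⟨S, _, hfin, inferInstance, contGraph S hS, ⟨[p], .inr (cons_mem_conts _ _)⟩,
    ⟨[], .inl rfl⟩, fun N N' => ⟨fun h => ?_, fun h =>
      h.reflTransGen_contGraph _ _ (Set.subset_insert _ _)⟩⟩
  have key : ∀ c, Relation.ReflTransGen (contGraph S hS).Step c (⟨[], .inl rfl⟩, N') →
      RunsList c.1.1 c.2 N' := by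
    intro c hc
    induction hc using Relation.ReflTransGen.head_induction_on with
    | refl => rfl
    | head h _ ih =>
      obtain ⟨e, h1, h2, h3⟩ := h
      rw [h1]
      rw [h2] at ih
      exact ih.of_mem_succs e.2.2 h3
  obtain ⟨x, hx, rfl⟩ := key _ h
  exact hx

end Prog

/-- Reachability in a fixed automaton, from a number that depends on the input, is as hard as the
halting problem. -/
theorem exists_affineGraph_iff_halts : ∃ (Q E : Type) (_ : Finite Q) (_ : Finite E)
    (G : AffineGraph Q E) (q₀ q₁ : Q), ∀ n,
      (∃ N, Relation.ReflTransGen G.Step (q₀, 2 ^ n) (q₁, N)) ↔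
      (Nat.Partrec.Code.eval (Denumerable.ofNat Nat.Partrec.Code n) 0).Dom := by
  obtain ⟨p, hp⟩ := Prog.exists_runs_iff_halts
  obtain ⟨Q, E, hQ, hE, G, q₀, q₁, hG⟩ := p.exists_affineGraph
  refine ⟨Q, E, hQ, hE, G, q₀, q₁, fun n => ?_⟩
  rw [← hp, ← regCode_update_zero (K := p.regBound + 1) (by omega)]
  simp only [hG, p.runs_regCode_iff (Nat.le_succ _)]
  exact ⟨fun ⟨_, w, hw, _⟩ => ⟨w, hw⟩, fun ⟨w, hw⟩ => ⟨_, w, hw, rfl⟩⟩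

/-! ### The simulating net -/

namespace AffineGraph

/-- The places of the net that simulates an automaton with states `Q` and edges `E`. The counters
`a` and `b` are mirrored in `sum`; `trash` receives what transfer arcs take away. The other places
hold the control: `state q`, while no edge is being followed, and otherwise a phase that is shared
by all edges together with the token in `back e`, which remembers the edge (in the phase
`load e` it is not needed). -/
inductive Place (Q E : Type) where
  | a | b | sum | trash
  | state (q : Q) | load (e : E) | back (e : E)
  | callA | unload | doneB | drain | goal
  deriving DecidableEq, Fintype

/-- The transitions of the net that simulates an automaton with edges `E`. -/
inductive Transition (E : Type) where
  | start (e : E) | load (e : E) | call (e : E)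
  | resetA | unload | resetB | finish (e : E)
  | halt | drain | test
  deriving DecidableEq, Fintype

variable {Q E : Type} [DecidableEq Q] [DecidableEq E] (G : AffineGraph Q E) (q₁ : Q)

/-- The weights of the ordinary arcs from places to transitions. -/
def need : Transition E → Place Q E → ℕ
  | .start e => Pi.single (.state (G.src e)) 1
  | .load e => Pi.single (.load e) 1 + Pi.single .a (G.label e).d + Pi.single .sum (G.label e).d
  | .call e => Pi.single (.load e) 1 + Pi.single .a (G.label e).r + Pi.single .sum (G.label e).r
  | .resetA => Pi.single .callA 1
  | .unload => Pi.single .unload 1 + Pi.single .b 1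
  | .resetB => Pi.single .unload 1
  | .finish e => Pi.single .doneB 1 + Pi.single (.back e) 1
  | .halt => Pi.single (.state q₁) 1
  | .drain => Pi.single .drain 1 + Pi.single .a 1 + Pi.single .sum 1
  | .test => Pi.single .drain 1

/-- The weights of the arcs from transitions to places. -/
def give : Transition E → Place Q E → ℕ
  | .start e => Pi.single (.load e) 1
  | .load e => Pi.single (.load e) 1 + Pi.single .b (G.label e).m + Pi.single .sum (G.label e).m
  | .call e => Pi.single .callA 1 + Pi.single (.back e) 1
  | .resetA => Pi.single .unload 1
  | .unload => Pi.single .unload 1 + Pi.single .a 1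
  | .resetB => Pi.single .doneB 1
  | .finish e => Pi.single (.state (G.tgt e)) 1 + Pi.single .a (G.label e).s +
      Pi.single .sum (G.label e).s
  | .halt => Pi.single .drain 1
  | .drain => Pi.single .drain 1
  | .test => Pi.single .goal 1

/-- The control states of the net. -/
inductive Control (Q E : Type) where
  | state (q : Q) | load (e : E) | callA (e : E) | unload (e : E) | doneB (e : E) | drain | goal

/-- The tokens that make up a control state. -/
def Control.marking : Control Q E → Place Q E → ℕ
  | .state q => Pi.single (.state q) 1
  | .load e => Pi.single (.load e) 1
  | .callA e => Pi.single .callA 1 + Pi.single (.back e) 1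
  | .unload e => Pi.single .unload 1 + Pi.single (.back e) 1
  | .doneB e => Pi.single .doneB 1 + Pi.single (.back e) 1
  | .drain => Pi.single .drain 1
  | .goal => Pi.single .goal 1

/-- The marking with the control state `c`, with `x` and `y` tokens in the counters and `z` tokens
in their sum. -/
def conf (c : Control Q E) (x y z : ℕ) : Place Q E → ℕ :=
  c.marking + Pi.single .a x + Pi.single .b y + Pi.single .sum z

/-- The net that simulates `G`, started in the state `q₀` at the number `N`, and that marks the
place `goal` when it reaches the state `q₁`. The arcs `κ` empty the counters, to test them for zero;
cheating makes the counters smaller than their sum for ever, and this is detected by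
the inhibitor arc, which is used once, at the end. -/
def net (κ : PreArc (Place Q E)) (q₀ : Q) (N : ℕ) : PetriNet (Place Q E) (Transition E) where
  pre p t :=
    if (p = .a ∧ t = .resetA) ∨ (p = .b ∧ t = .resetB) then κ
    else if p = .sum ∧ t = .test then .inhibitor
    else .weight (need G q₁ t p)
  post := give G
  init := conf (.state q₀) N 0 N

variable {G q₁} {κ : PreArc (Place Q E)} {q₀ : Q} {N : ℕ}

theorem firable_iff (hκ : κ = .reset ∨ κ = .transfer .trash) (t : Transition E)
    (M : Place Q E → ℕ) : (net G q₁ κ q₀ N).Firable t M ↔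
      (∀ p, need G q₁ t p ≤ M p) ∧ (t = .test → M .sum = 0) := by
  simp only [PetriNet.Firable, net]
  constructor
  · rintro ⟨h1, h2⟩
    refine ⟨fun p => ?_, fun ht => h2 _ (by simp [ht])⟩
    by_cases hp : (p = .a ∧ t = .resetA) ∨ (p = .b ∧ t = .resetB)
    · rcases hp with ⟨rfl, rfl⟩ | ⟨rfl, rfl⟩ <;> simp [need]
    by_cases hp' : p = .sum ∧ t = .test
    · rcases hp' with ⟨rfl, rfl⟩
      simp [need]
    · exact h1 p _ (by rw [if_neg hp, if_neg hp'])
  · rintro ⟨h1, h2⟩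
    constructor
    · intro p k h
      split_ifs at h
      · rcases hκ with rfl | rfl <;> simp at h
      · rw [← PreArc.weight.inj h]
        exact h1 p
    · intro p h
      split_ifs at h with h3 h4
      · rcases hκ with rfl | rfl <;> simp at h
      · rw [h4.1]
        exact h2 h4.2

variable [Fintype Q] [Fintype E]

theorem fire_apply (hκ : κ = .reset ∨ κ = .transfer .trash) (t : Transition E)
    (M : Place Q E → ℕ) {p : Place Q E} (hp : p ≠ .trash) :
    (net G q₁ κ q₀ N).fire t M p =
      (if (p = .a ∧ t = .resetA) ∨ (p = .b ∧ t = .resetB) then 0 else M p - need G q₁ t p) +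
        give G t p := by
  have h0 : ∑ q with (net G q₁ κ q₀ N).pre q t = .transfer p, M q = 0 := by
    refine Finset.sum_eq_zero fun q hq => ?_
    replace hq := (Finset.mem_filter.1 hq).2
    simp only [net] at hq
    rcases hκ with rfl | rfl
    · split_ifs at hq
    · split_ifs at hq
      simp_all [eq_comm]
  rw [PetriNet.fire, h0, PetriNet.remaining, add_zero]
  congr 1
  simp only [net]
  split_ifs with h1 h2
  · rcases hκ with rfl | rfl <;> rfl
  · obtain ⟨rfl, rfl⟩ := h2
    simp [need]
  · rfl

/-! ### Honest runs of the net -/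

/-- Without cheating, the net behaves as if the special arcs had weight zero. -/
theorem step_of_clean (hκ : κ = .reset ∨ κ = .transfer .trash) (t : Transition E)
    {M M' : Place Q E → ℕ} (hM : ∀ p, need G q₁ t p ≤ M p)
    (hM' : ∀ p, M' p = M p - need G q₁ t p + give G t p)
    (ha : t = .resetA → M .a = 0) (hb : t = .resetB → M .b = 0) (hs : t = .test → M .sum = 0) :
    (net G q₁ κ q₀ N).Step M M' := by
  refine ⟨t, (firable_iff hκ t M).2 ⟨hM, hs⟩, funext fun p => ?_⟩
  rw [hM']
  by_cases hp : p = .trash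
  · subst hp
    have h0 : ∑ q with (net G q₁ κ q₀ N).pre q t = .transfer .trash, M q = 0 := by
      refine Finset.sum_eq_zero fun q hq => ?_
      replace hq := (Finset.mem_filter.1 hq).2
      simp only [net] at hq
      split_ifs at hq with h
      · rcases h with ⟨rfl, rfl⟩ | ⟨rfl, rfl⟩
        · exact ha rfl
        · exact hb rfl
    rw [PetriNet.fire, h0]
    simp [PetriNet.remaining, net]
  · rw [fire_apply hκ t M hp]
    split_ifs with h
    · rcases h with ⟨rfl, rfl⟩ | ⟨rfl, rfl⟩
      · rw [ha rfl, Nat.zero_sub]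
      · rw [hb rfl, Nat.zero_sub]
    · rfl

open Relation in
theorem reflTransGen_load (hκ : κ = .reset ∨ κ = .transfer .trash) (e : E) (i x y z : ℕ) :
    ReflTransGen (net G q₁ κ q₀ N).Step
      (conf (.load e) (x + (G.label e).d * i) y (z + (G.label e).d * i))
      (conf (.load e) x (y + (G.label e).m * i) (z + (G.label e).m * i)) := by
  induction i generalizing y z with
  | zero => exact .refl
  | succ i ih =>
    have h := ih (y + (G.label e).m) (z + (G.label e).m)
    simp only [mul_add, mul_one, ← add_assoc]
    rw [add_right_comm y, add_right_comm z _ (G.label e).m]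
    refine .head (step_of_clean hκ (.load e) ?_ ?_ ?_ ?_ ?_) h
    · rintro (_ | _) <;> simp [need, conf, Control.marking, Pi.single_apply]
    · rintro (_ | _) <;> simp [need, give, conf, Control.marking, Pi.single_apply]
      omega
    all_goals simp

open Relation in
theorem reflTransGen_unload (hκ : κ = .reset ∨ κ = .transfer .trash) (e : E) (x y z : ℕ) :
    ReflTransGen (net G q₁ κ q₀ N).Step (conf (.unload e) x y z) (conf (.unload e) (x + y) 0 z) := by
  induction y generalizing x with
  | zero => exact .refl
  | succ y ih =>
    have h := ih (x + 1)
    rw [add_assoc, add_comm 1] at h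
    refine .head (step_of_clean hκ .unload ?_ ?_ ?_ ?_ ?_) h
    · rintro (_ | _) <;> simp [need, conf, Control.marking, Pi.single_apply]
    · rintro (_ | _) <;> simp [need, give, conf, Control.marking, Pi.single_apply]
    all_goals simp

open Relation in
theorem reflTransGen_drain (hκ : κ = .reset ∨ κ = .transfer .trash) (x : ℕ) :
    ReflTransGen (net G q₁ κ q₀ N).Step (conf .drain x 0 x) (conf .drain 0 0 0) := by
  induction x with
  | zero => exact .refl
  | succ x ih =>
    refine .head (step_of_clean hκ .drain ?_ ?_ ?_ ?_ ?_) ih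
    · rintro (_ | _) <;> simp [need, conf, Control.marking]
    · rintro (_ | _) <;> simp [need, give, conf, Control.marking]
    all_goals simp

open Relation in
/-- The net follows an edge of the automaton. -/
theorem reflTransGen_of_rel (hκ : κ = .reset ∨ κ = .transfer .trash) (e : E) {A B : ℕ}
    (h : (G.label e).Rel A B) : ReflTransGen (net G q₁ κ q₀ N).Step
      (conf (.state (G.src e)) A 0 A) (conf (.state (G.tgt e)) B 0 B) := by
  obtain ⟨i, rfl, rfl⟩ := h
  have hload := reflTransGen_load (G := G) (q₁ := q₁) (q₀ := q₀) (N := N) hκ e i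
    (G.label e).r 0 (G.label e).r
  have hunload := reflTransGen_unload (G := G) (q₁ := q₁) (q₀ := q₀) (N := N) hκ e 0
    ((G.label e).m * i) ((G.label e).m * i)
  rw [add_comm ((G.label e).d * i)]
  rw [zero_add] at hload hunload
  have hstart : ∀ x, (net G q₁ κ q₀ N).Step (conf (.state (G.src e)) x 0 x)
      (conf (.load e) x 0 x) := by
    refine fun x => step_of_clean hκ (.start e) ?_ ?_ ?_ ?_ ?_
    · rintro (_ | _) <;> simp [need, conf, Control.marking, Pi.single_apply]
    · rintro (_ | _) <;> simp [need, give, conf, Control.marking, Pi.single_apply]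
    all_goals simp
  have hcall : ∀ y, (net G q₁ κ q₀ N).Step (conf (.load e) (G.label e).r y ((G.label e).r + y))
      (conf (.callA e) 0 y y) := by
    refine fun x => step_of_clean hκ (.call e) ?_ ?_ ?_ ?_ ?_
    · rintro (_ | _) <;> simp [need, conf, Control.marking, Pi.single_apply]
    · rintro (_ | _) <;> simp [need, give, conf, Control.marking, Pi.single_apply]
    all_goals simp
  have hresetA : ∀ y, (net G q₁ κ q₀ N).Step (conf (.callA e) 0 y y)
      (conf (.unload e) 0 y y) := by
    refine fun x => step_of_clean hκ .resetA ?_ ?_ ?_ ?_ ?_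
    · rintro (_ | _) <;> simp [need, conf, Control.marking, Pi.single_apply]
    · rintro (_ | _) <;> simp [need, give, conf, Control.marking, Pi.single_apply]
    all_goals simp [conf, Control.marking]
  have hresetB : ∀ x, (net G q₁ κ q₀ N).Step (conf (.unload e) x 0 x)
      (conf (.doneB e) x 0 x) := by
    refine fun x => step_of_clean hκ .resetB ?_ ?_ ?_ ?_ ?_
    · rintro (_ | _) <;> simp [need, conf, Control.marking, Pi.single_apply]
    · rintro (_ | _) <;> simp [need, give, conf, Control.marking, Pi.single_apply]
    all_goals simp [conf, Control.marking]
  have hfinish : ∀ x, (net G q₁ κ q₀ N).Step (conf (.doneB e) x 0 x)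
      (conf (.state (G.tgt e)) (x + (G.label e).s) 0 (x + (G.label e).s)) := by
    refine fun x => step_of_clean hκ (.finish e) ?_ ?_ ?_ ?_ ?_
    · rintro (_ | _) <;> simp [need, conf, Control.marking, Pi.single_apply]
    · rintro (_ | _) <;> simp [need, give, conf, Control.marking, Pi.single_apply]
    all_goals simp
  exact .head (hstart _) (hload.trans (.head (hcall _) (.head (hresetA _)
    (hunload.trans (.head (hresetB _) (.single (hfinish _)))))))

/-! ### Arbitrary runs of the net -/

/-- What the control state tells about the counters if there has been no cheating. Here `R q A` says
that the automaton reaches the state `q` with the number `A`. -/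
def Meaning (G : AffineGraph Q E) (q₁ : Q) (R : Q → ℕ → Prop) : Control Q E → ℕ → ℕ → Prop
  | .state q, x, y => y = 0 ∧ R q x
  | .load e, x, y => ∃ i, R (G.src e) (x + (G.label e).d * i) ∧ y = (G.label e).m * i
  | .callA e, x, y => ∃ i, R (G.src e) (x + (G.label e).d * i + (G.label e).r) ∧
      y = (G.label e).m * i
  | .unload e, x, y => ∃ i, R (G.src e) ((G.label e).d * i + (G.label e).r) ∧
      x + y = (G.label e).m * i
  | .doneB e, x, y => ∃ i, R (G.src e) ((G.label e).d * i + (G.label e).r) ∧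
      x = (G.label e).m * i ∧ y = 0
  | .drain, _, _ => ∃ A, R q₁ A
  | .goal, _, _ => ∃ A, R q₁ A

/-- The invariant of the net: it is in a control state, the counters do not exceed `sum`, and if
they match it then there has been no cheating. The inhibitor arc ensures that `sum` is empty when
the place `goal` is marked, so that the counters match it then. -/
def Invariant (G : AffineGraph Q E) (q₁ : Q) (R : Q → ℕ → Prop) (M : Place Q E → ℕ) : Prop :=
  ∃ c : Control Q E,
    (∀ p, p ≠ .a → p ≠ .b → p ≠ .sum → p ≠ .trash → M p = c.marking p) ∧
    (c = .goal → M .sum = 0) ∧ M .a + M .b ≤ M .sum ∧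
    (M .a + M .b = M .sum → Meaning G q₁ R c (M .a) (M .b))

theorem Invariant.step (hκ : κ = .reset ∨ κ = .transfer .trash) {R : Q → ℕ → Prop}
    (hR : ∀ e A B, R (G.src e) A → (G.label e).Rel A B → R (G.tgt e) B) {M M' : Place Q E → ℕ}
    (hM : Invariant G q₁ R M) (h : (net G q₁ κ q₀ N).Step M M') : Invariant G q₁ R M' := by
  obtain ⟨c, hc, hgoal, hle, hmean⟩ := hM
  obtain ⟨t, hf, rfl⟩ := h
  obtain ⟨hneed, htest⟩ := (firable_iff hκ t M).1 hf
  have hfire := fun p hp => fire_apply (G := G) (q₁ := q₁) (q₀ := q₀) (N := N) hκ t M (p := p) hp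
  generalize (net G q₁ κ q₀ N).fire t M = M' at *
  have ha := hfire .a (by simp)
  have hb := hfire .b (by simp)
  have hs := hfire .sum (by simp)
  have hctrl : ∀ p, p ≠ .a → p ≠ .b → p ≠ .sum → p ≠ .trash →
      M' p = c.marking p - need G q₁ t p + give G t p := by
    intro p h1 h2 h3 h4
    rw [hfire p h4, if_neg (by simp [h1, h2]), hc p h1 h2 h3 h4]
  have hneedc : ∀ p, p ≠ .a → p ≠ .b → p ≠ .sum → p ≠ .trash →
      need G q₁ t p ≤ c.marking p := by
    intro p h1 h2 h3 h4
    rw [← hc p h1 h2 h3 h4]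
    exact hneed p
  have hna := hneed .a
  have hnb := hneed .b
  have hns := hneed .sum
  cases t with
  | start e =>
    have h := hneedc (.state (G.src e)) (by simp) (by simp) (by simp) (by simp)
    cases c <;> simp [need, Control.marking, Pi.single_apply, Nat.one_le_iff_ne_zero] at h
    subst h
    simp [need, give] at ha hb hs
    refine ⟨.load e, ?_, by simp, by omega, fun h => ?_⟩
    · intro p h1 h2 h3 h4
      rw [hctrl p h1 h2 h3 h4]
      cases p <;> first | contradiction | simp [need, give, Control.marking, Pi.single_apply]
    · obtain ⟨h0, h1⟩ := hmean (by omega)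
      refine ⟨0, ?_, ?_⟩ <;> simpa [ha, hb]
  | load e =>
    have h := hneedc (.load e) (by simp) (by simp) (by simp) (by simp)
    cases c <;> simp [need, Control.marking, Pi.single_apply, Nat.one_le_iff_ne_zero] at h
    subst h
    simp [need, give] at ha hb hs hna hnb hns
    refine ⟨.load e, ?_, by simp, by omega, fun h => ?_⟩
    · intro p h1 h2 h3 h4
      rw [hctrl p h1 h2 h3 h4]
      cases p <;> first | contradiction | simp [need, give, Control.marking, Pi.single_apply]
    · obtain ⟨i, h0, h1⟩ := hmean (by omega)
      refine ⟨i + 1, ?_, ?_⟩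
      · convert h0 using 1
        rw [mul_add]
        omega
      · rw [mul_add]
        omega
  | call e =>
    have h := hneedc (.load e) (by simp) (by simp) (by simp) (by simp)
    cases c <;> simp [need, Control.marking, Pi.single_apply, Nat.one_le_iff_ne_zero] at h
    subst h
    simp [need, give] at ha hb hs hna hnb hns
    refine ⟨.callA e, ?_, by simp, by omega, fun h => ?_⟩
    · intro p h1 h2 h3 h4
      rw [hctrl p h1 h2 h3 h4]
      cases p <;> first | contradiction | simp [need, give, Control.marking, Pi.single_apply]
    · obtain ⟨i, h0, h1⟩ := hmean (by omega)
      refine ⟨i, ?_, by omega⟩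
      convert h0 using 1
      omega
  | resetA =>
    have h := hneedc .callA (by simp) (by simp) (by simp) (by simp)
    cases c <;> simp [need, Control.marking] at h
    rename_i e
    simp [need, give] at ha hb hs
    refine ⟨.unload e, ?_, by simp, by omega, fun h => ?_⟩
    · intro p h1 h2 h3 h4
      rw [hctrl p h1 h2 h3 h4]
      cases p <;> first | contradiction | simp [need, give, Control.marking, Pi.single_apply]
    · obtain ⟨i, h0, h1⟩ := hmean (by omega)
      refine ⟨i, ?_, by omega⟩
      convert h0 using 1
      omega
  | unload =>
    have h := hneedc .unload (by simp) (by simp) (by simp) (by simp)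
    cases c <;> simp [need, Control.marking] at h
    rename_i e
    simp [need, give] at ha hb hs hna hnb hns
    refine ⟨.unload e, ?_, by simp, by omega, fun h => ?_⟩
    · intro p h1 h2 h3 h4
      rw [hctrl p h1 h2 h3 h4]
      cases p <;> first | contradiction | simp [need, give, Control.marking, Pi.single_apply]
    · obtain ⟨i, h0, h1⟩ := hmean (by omega)
      exact ⟨i, h0, by omega⟩
  | resetB =>
    have h := hneedc .unload (by simp) (by simp) (by simp) (by simp)
    cases c <;> simp [need, Control.marking] at h
    rename_i e
    simp [need, give] at ha hb hs
    refine ⟨.doneB e, ?_, by simp, by omega, fun h => ?_⟩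
    · intro p h1 h2 h3 h4
      rw [hctrl p h1 h2 h3 h4]
      cases p <;> first | contradiction | simp [need, give, Control.marking, Pi.single_apply]
    · obtain ⟨i, h0, h1⟩ := hmean (by omega)
      exact ⟨i, h0, by omega, by omega⟩
  | finish e =>
    have h := hneedc .doneB (by simp) (by simp) (by simp) (by simp)
    have h' := hneedc (.back e) (by simp) (by simp) (by simp) (by simp)
    cases c <;> simp [need, Control.marking, Pi.single_apply, Nat.one_le_iff_ne_zero] at h h'
    subst h'
    simp [need, give] at ha hb hs
    refine ⟨.state (G.tgt e), ?_, by simp, by omega, fun h => ?_⟩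
    · intro p h1 h2 h3 h4
      rw [hctrl p h1 h2 h3 h4]
      cases p <;> first | contradiction | simp [need, give, Control.marking, Pi.single_apply]
    · obtain ⟨i, h0, h1, h2⟩ := hmean (by omega)
      exact ⟨by omega, hR e _ _ h0 ⟨i, rfl, by omega⟩⟩
  | halt =>
    have h := hneedc (.state q₁) (by simp) (by simp) (by simp) (by simp)
    cases c <;> simp [need, Control.marking, Pi.single_apply, Nat.one_le_iff_ne_zero] at h
    subst h
    simp [need, give] at ha hb hs
    refine ⟨.drain, ?_, by simp, by omega, fun h => ?_⟩
    · intro p h1 h2 h3 h4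
      rw [hctrl p h1 h2 h3 h4]
      cases p <;> first | contradiction | simp [need, give, Control.marking, Pi.single_apply]
    · exact ⟨_, (hmean (by omega)).2⟩
  | drain =>
    have h := hneedc .drain (by simp) (by simp) (by simp) (by simp)
    cases c <;> simp [need, Control.marking] at h
    simp [need, give] at ha hb hs hna hnb hns
    refine ⟨.drain, ?_, by simp, by omega, fun h => hmean (by omega)⟩
    intro p h1 h2 h3 h4
    rw [hctrl p h1 h2 h3 h4]
    cases p <;> first | contradiction | simp [need, give, Control.marking]
  | test =>
    have h := hneedc .drain (by simp) (by simp) (by simp) (by simp)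
    cases c <;> simp [need, Control.marking] at h
    simp [need, give] at ha hb hs htest
    refine ⟨.goal, ?_, by omega, by omega, fun h => hmean (by omega)⟩
    intro p h1 h2 h3 h4
    rw [hctrl p h1 h2 h3 h4]
    cases p <;> first | contradiction | simp [need, give, Control.marking]

open Relation in
theorem coverable_net_iff (hκ : κ = .reset ∨ κ = .transfer .trash) :
    (net G q₁ κ q₀ N).Coverable (Pi.single .goal 1) ↔
      ∃ A, ReflTransGen G.Step (q₀, N) (q₁, A) := by
  constructor
  · rintro ⟨M, hM, hreach⟩
    have key : Invariant G q₁ (fun q A => ReflTransGen G.Step (q₀, N) (q, A)) M := by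
      clear hM
      change ReflTransGen _ _ _ at hreach
      induction hreach with
      | refl =>
        refine ⟨.state q₀, ?_, by simp, by simp [net, conf, Control.marking], fun _ => ?_⟩
        · intro p h1 h2 h3 h4
          simp [net, conf, h1, h3]
        · simp [Meaning, net, conf, Control.marking, ReflTransGen.refl]
      | tail _ h ih =>
        exact ih.step hκ (fun e A B h hAB => h.tail ⟨e, rfl, rfl, hAB⟩) h
    obtain ⟨c, hc, hgoal, hle, hmean⟩ := key
    have h := hM .goal
    rw [hc _ (by simp) (by simp) (by simp) (by simp)] at h
    cases c <;> simp [Control.marking] at h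
    -- only the control state `goal` is left, where `sum` and hence both counters are empty
    have := hgoal rfl
    exact hmean (by omega)
  · rintro ⟨A, h⟩
    have key : ∀ c, ReflTransGen G.Step (q₀, N) c → ReflTransGen (net G q₁ κ q₀ N).Step
        (conf (.state q₀) N 0 N) (conf (.state c.1) c.2 0 c.2) := by
      intro c hc
      induction hc with
      | refl => exact .refl
      | tail _ h ih =>
        obtain ⟨e, h1, h2, h3⟩ := h
        rw [h1] at ih
        rw [h2]
        exact ih.trans (reflTransGen_of_rel hκ e h3)
    have hhalt : (net G q₁ κ q₀ N).Step (conf (.state q₁) A 0 A) (conf .drain A 0 A) := by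
      refine step_of_clean hκ .halt ?_ ?_ ?_ ?_ ?_
      · rintro (_ | _) <;> simp [need, conf, Control.marking, Pi.single_apply]
      · rintro (_ | _) <;> simp [need, give, conf, Control.marking, Pi.single_apply]
      all_goals simp
    have htest : (net G q₁ κ q₀ N).Step (conf .drain 0 0 0) (conf .goal 0 0 0) := by
      refine step_of_clean hκ .test ?_ ?_ ?_ ?_ ?_
      · rintro (_ | _) <;> simp [need, conf, Control.marking]
      · rintro (_ | _) <;> simp [need, give, conf, Control.marking]
      all_goals simp [conf, Control.marking]
    refine ⟨conf .goal 0 0 0, by simp [conf, Control.marking], ?_⟩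
    exact ((key _ h).trans (.head hhalt (reflTransGen_drain hκ A))).tail htest

end AffineGraph

/-! ### Renaming places and transitions -/

/-- Renaming the places in an arc. -/
def PreArc.map {P P' : Type} (f : P → P') : PreArc P → PreArc P'
  | .weight k => .weight k
  | .inhibitor => .inhibitor
  | .reset => .reset
  | .transfer q => .transfer (f q)

namespace PetriNet

variable {P T P' T' : Type} (N : PetriNet P T) (eP : P ≃ P') (eT : T ≃ T')

/-- Renaming the places and the transitions of a net. -/
def reindex : PetriNet P' T' where
  pre p t := (N.pre (eP.symm p) (eT.symm t)).map eP
  post t p := N.post (eT.symm t) (eP.symm p)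
  init := N.init ∘ eP.symm

theorem reindex_firable_iff (t : T') (M : P' → ℕ) :
    (N.reindex eP eT).Firable t M ↔ N.Firable (eT.symm t) (M ∘ eP) := by
  simp only [Firable, reindex, eP.surjective.forall, Equiv.symm_apply_apply, Function.comp]
  refine and_congr (forall_congr' fun p => forall_congr' fun k => imp_congr_left ?_)
    (forall_congr' fun p => imp_congr_left ?_)
  all_goals cases N.pre p (eT.symm t) <;> simp [PreArc.map]

variable [Fintype P] [DecidableEq P] [Fintype P'] [DecidableEq P']

theorem reindex_fire (t : T') (M : P' → ℕ) :
    (N.reindex eP eT).fire t M ∘ eP = N.fire (eT.symm t) (M ∘ eP) := by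
  funext p
  have hrem : (N.reindex eP eT).remaining t M (eP p) =
      N.remaining (eT.symm t) (M ∘ eP) p := by
    simp only [remaining, reindex, Equiv.symm_apply_apply]
    cases N.pre p (eT.symm t) <;> rfl
  have hsum : ∑ q with N.pre q (eT.symm t) = .transfer p, (M ∘ eP) q =
      ∑ q with (N.reindex eP eT).pre q t = .transfer (eP p), M q := by
    refine Finset.sum_equiv eP (fun q => ?_) (fun _ _ => rfl)
    simp only [Finset.mem_filter, Finset.mem_univ, true_and]
    simp only [reindex, Equiv.symm_apply_apply]
    cases N.pre q (eT.symm t) <;> simp [PreArc.map]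
  rw [Function.comp, fire, hrem, ← hsum, fire]
  simp [reindex]

theorem reindex_step_iff (A B : P' → ℕ) :
    (N.reindex eP eT).Step A B ↔ N.Step (A ∘ eP) (B ∘ eP) := by
  simp only [Step, eT.symm.surjective.exists (p := fun t => N.Firable t (A ∘ eP) ∧ _),
    reindex_firable_iff, ← reindex_fire, eP.surjective.injective_comp_right.eq_iff]

theorem reindex_coverable_iff (M : P' → ℕ) :
    (N.reindex eP eT).Coverable M ↔ N.Coverable (M ∘ eP) := by
  constructor
  · rintro ⟨M', hle, h⟩
    refine ⟨M' ∘ eP, fun p => hle (eP p), ?_⟩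
    have := Relation.ReflTransGen.lift (r := (N.reindex eP eT).Step) (p := N.Step) (· ∘ eP)
      (fun A B => (N.reindex_step_iff eP eT A B).1) _ _ h
    simpa [reindex, Function.comp_assoc, Function.onFun, Reachable] using this
  · rintro ⟨M', hle, h⟩
    refine ⟨M' ∘ eP.symm, fun p => by simpa using hle (eP.symm p), ?_⟩
    refine Relation.ReflTransGen.lift (p := (N.reindex eP eT).Step) (· ∘ eP.symm)
      (fun A B hAB => ?_) _ _ h
    simpa [reindex_step_iff, Function.comp_assoc] using hAB

variable [Fintype T] [Fintype T']

theorem numInhibitor_reindex : (N.reindex eP eT).numInhibitor = N.numInhibitor := by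
  refine Finset.card_equiv (eP.symm.prodCongr eT.symm) fun x => ?_
  simp only [Finset.mem_filter, Finset.mem_univ, true_and, Equiv.prodCongr_apply, Prod.map]
  simp only [reindex]
  cases N.pre (eP.symm x.1) (eT.symm x.2) <;> simp [PreArc.map]

theorem numReset_reindex : (N.reindex eP eT).numReset = N.numReset := by
  refine Finset.card_equiv (eP.symm.prodCongr eT.symm) fun x => ?_
  simp only [Finset.mem_filter, Finset.mem_univ, true_and, Equiv.prodCongr_apply, Prod.map]
  simp only [reindex]
  cases N.pre (eP.symm x.1) (eT.symm x.2) <;> simp [PreArc.map]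

theorem numTransfer_reindex : (N.reindex eP eT).numTransfer = N.numTransfer := by
  refine Finset.card_equiv (eP.symm.prodCongr eT.symm) fun x => ?_
  simp only [Finset.mem_filter, Finset.mem_univ, true_and, Equiv.prodCongr_apply, Prod.map]
  simp only [reindex]
  cases N.pre (eP.symm x.1) (eT.symm x.2) <;> simp [PreArc.map]

end PetriNet

/-! ### Description and arc counts of the net -/

namespace AffineGraph

variable {Q E : Type} [DecidableEq Q] [DecidableEq E]
  (G : AffineGraph Q E) (q₀ q₁ : Q) (κ : PreArc (Place Q E)) (N : ℕ)

/-- Only the initial marking of the net depends on the number `N`, and so its description can be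
computed from the exponent of `N = 2 ^ n`. -/
theorem computable_encode_net {k m : ℕ} (eP : Place Q E ≃ Fin k) (eT : Transition E ≃ Fin m)
    (M : Fin k → ℕ) :
    Computable fun n => ((net G q₁ κ q₀ (2 ^ n)).reindex eP eT).encode M := by
  suffices h : Primrec fun n => List.ofFn ((net G q₁ κ q₀ (2 ^ n)).reindex eP eT).init from
    (Computable.const (((net G q₁ κ q₀ 0).reindex eP eT).encode M).1).pair
      (h.to_comp.pair (Computable.const (List.ofFn M)))
  refine Primrec.list_ofFn fun i => ?_
  have hpow : Primrec fun n : ℕ => 2 ^ n :=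
    (Primrec₂.unpaired'.1 Nat.Primrec.pow).comp (.const 2) .id
  have hinit : ∀ n, ((net G q₁ κ q₀ (2 ^ n)).reindex eP eT).init i =
      (Control.state q₀ : Control Q E).marking (eP.symm i) +
        if eP.symm i = .a ∨ eP.symm i = .sum then 2 ^ n else 0 := by
    intro n
    simp only [PetriNet.reindex, net, conf, Function.comp, Pi.add_apply, Pi.single_zero,
      Pi.single_apply, add_zero]
    split_ifs <;> simp_all
  simp only [hinit]
  by_cases h : eP.symm i = .a ∨ eP.symm i = .sum
  · simp only [h, if_true]
    exact Primrec.nat_add.comp (.const _) hpow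
  · simp only [h, if_false]
    exact .const _

variable [Fintype Q] [Fintype E]

theorem numInhibitor_net (hκ : κ = .reset ∨ κ = .transfer .trash) :
    (net G q₁ κ q₀ N).numInhibitor = 1 := by
  have : (Finset.univ.filter fun x : Place Q E × Transition E =>
      (net G q₁ κ q₀ N).pre x.1 x.2 = .inhibitor) = {(.sum, .test)} := by
    ext ⟨p, t⟩
    simp only [Finset.mem_filter, Finset.mem_univ, true_and, Finset.mem_singleton, Prod.mk.injEq]
    simp only [net]
    split_ifs with h
    · rcases h with ⟨rfl, rfl⟩ | ⟨rfl, rfl⟩ <;> rcases hκ with rfl | rfl <;> simp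
    · simp_all
    · simp_all
  rw [PetriNet.numInhibitor, this, Finset.card_singleton]

theorem numReset_net_reset : (net G q₁ .reset q₀ N).numReset = 2 := by
  have : (Finset.univ.filter fun x : Place Q E × Transition E =>
      (net G q₁ .reset q₀ N).pre x.1 x.2 = .reset) = {(.a, .resetA), (.b, .resetB)} := by
    ext ⟨p, t⟩
    simp only [Finset.mem_filter, Finset.mem_univ, true_and, Finset.mem_insert,
      Finset.mem_singleton, Prod.mk.injEq]
    simp only [net]
    split_ifs <;> simp_all
  rw [PetriNet.numReset, this, Finset.card_pair (by simp)]

theorem numTransfer_net_reset : (net G q₁ .reset q₀ N).numTransfer = 0 := by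
  rw [PetriNet.numTransfer, Finset.card_eq_zero, Finset.filter_eq_empty_iff]
  rintro ⟨p, t⟩ -
  simp only [net]
  split_ifs <;> simp

theorem numReset_net_transfer : (net G q₁ (.transfer .trash) q₀ N).numReset = 0 := by
  rw [PetriNet.numReset, Finset.card_eq_zero, Finset.filter_eq_empty_iff]
  rintro ⟨p, t⟩ -
  simp only [net]
  split_ifs <;> simp

theorem numTransfer_net_transfer : (net G q₁ (.transfer .trash) q₀ N).numTransfer = 2 := by
  have : (Finset.univ.filter fun x : Place Q E × Transition E =>
      ∃ q, (net G q₁ (.transfer .trash) q₀ N).pre x.1 x.2 = .transfer q) =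
      {(.a, .resetA), (.b, .resetB)} := by
    ext ⟨p, t⟩
    simp only [Finset.mem_filter, Finset.mem_univ, true_and, Finset.mem_insert,
      Finset.mem_singleton, Prod.mk.injEq]
    simp only [net]
    split_ifs <;> simp_all
  rw [PetriNet.numTransfer, this, Finset.card_pair (by simp)]

end AffineGraph

/-! ### Undecidability -/

/-- Coverability is undecidable for every class of nets that contains the simulating nets, for one
of the two kinds of arcs that empty the counters. -/
theorem not_coverabilityDecidable {C : ∀ n m : ℕ, PetriNet (Fin n) (Fin m) → Prop}
    (κ : ∀ Q E, PreArc (AffineGraph.Place Q E))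
    (hκ : ∀ Q E, κ Q E = .reset ∨ κ Q E = .transfer .trash)
    (hC : ∀ (Q E : Type) [Fintype Q] [Fintype E] [DecidableEq Q] [DecidableEq E]
      (G : AffineGraph Q E) (q₀ q₁ : Q) (N k m : ℕ) (eP : AffineGraph.Place Q E ≃ Fin k)
      (eT : AffineGraph.Transition E ≃ Fin m), C k m ((G.net q₁ (κ Q E) q₀ N).reindex eP eT)) :
    ¬ PetriNet.CoverabilityDecidable C := by
  rintro ⟨D, hD, hDC⟩
  obtain ⟨Q, E, hQ, hE, G, q₀, q₁, hG⟩ := exists_affineGraph_iff_halts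
  classical
  have := Fintype.ofFinite Q
  have := Fintype.ofFinite E
  let eP := Fintype.equivFin (AffineGraph.Place Q E)
  let eT := Fintype.equivFin (AffineGraph.Transition E)
  have hcomp := G.computable_encode_net q₀ q₁ (κ Q E) eP eT (Pi.single .goal 1 ∘ eP.symm)
  refine ComputablePred.halting_problem 0 (ComputablePred.computable_of_manyOneReducible
    ⟨_, hcomp.comp Computable.encode, fun c => ?_⟩ hD)
  rw [hDC _ _ _ _ (hC ..), PetriNet.reindex_coverable_iff, Function.comp_assoc,
    Equiv.symm_comp_self, Function.comp_id, AffineGraph.coverable_net_iff (hκ Q E), hG,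
    Denumerable.ofNat_encode]

theorem theorem4 :
    ¬ PetriNet.CoverabilityDecidable (fun _ _ N =>
        N.numReset = 2 ∧ N.numTransfer = 0 ∧ N.numInhibitor = 1) ∧
    ¬ PetriNet.CoverabilityDecidable (fun _ _ N =>
        N.numReset = 0 ∧ N.numTransfer = 2 ∧ N.numInhibitor = 1) := by
  constructor
  · refine not_coverabilityDecidable (fun _ _ => .reset) (fun _ _ => .inl rfl) ?_
    intros
    rw [PetriNet.numReset_reindex, PetriNet.numTransfer_reindex, PetriNet.numInhibitor_reindex]
    exact ⟨AffineGraph.numReset_net_reset .., AffineGraph.numTransfer_net_reset ..,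
      AffineGraph.numInhibitor_net _ _ _ _ _ (.inl rfl)⟩
  · refine not_coverabilityDecidable (fun _ _ => .transfer .trash) (fun _ _ => .inr rfl) ?_
    intros
    rw [PetriNet.numReset_reindex, PetriNet.numTransfer_reindex, PetriNet.numInhibitor_reindex]
    exact ⟨AffineGraph.numReset_net_transfer .., AffineGraph.numTransfer_net_transfer ..,
      AffineGraph.numInhibitor_net _ _ _ _ _ (.inr rfl)⟩
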